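/- Let $n\in\mathbb{N}$. An $n\times n$ real matrix $M=(M_{i,j})_{1\le i,j\le n}$ is called a reversible square if $$M_{i,j}+M_{i,n+1-j}=M_{i,k}+M_{i,n+1-k},\qquad M_{i,j}+M_{n+1-i,j}=M_{k,j}+M_{n+1-k,j}\qquad (i,j,k\in\{1,\dots,n\})$$ and $$M_{i,j}+M_{k,l}=M_{i,l}+M_{k,j}\qquad (i,j,k,l\in\{1,\dots,n\}).$$ For $n\ge 2$, it is called a principal reversible square if, in addition, $\{M_{i,j}\mid 1\le i,j\le n\}=\{1,2,\dots,n^2\}$, the entries in each row and in each column appear in increasing order, and $M_{1,1}=1$, $M_{1,2}=2$. Let $N_n$ denote the number of different $n\times n$ principal reversible squares. Let $n=p^a$, where $p$ is a prime and $a\in\mathbb{N}=\{1,2,3,\dots\}$. Then $$N_n=\binom{2a-1}{a}.$$ -/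

import Mathlib

/-- A real `n × n` matrix is a reversible square if it has the row and column reversal
symmetries and the vertex cross sum property. Rows and columns are numbered
from `0` to `n - 1` here, so that the passage from the 1-based index `j` to `n + 1 - j`
is `Fin.rev`. -/
structure IsReversibleSquare {n : ℕ} (M : Matrix (Fin n) (Fin n) ℝ) : Prop where
  row_reversal : ∀ i j k : Fin n, M i j + M i j.rev = M i k + M i k.rev
  col_reversal : ∀ i j k : Fin n, M i j + M i.rev j = M k j + M k.rev j
  vertex_cross_sum : ∀ i j k l : Fin n, M i j + M k l = M i l + M k j

/-- A principal reversible square: a reversible square whose set of entries is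
`{1, 2, …, n ^ 2}`, whose entries increase along each row and each column, and whose first row
begins with `1, 2`. -/
structure IsPrincipalReversibleSquare {n : ℕ} (M : Matrix (Fin n) (Fin n) ℝ) : Prop
    extends IsReversibleSquare M where
  entries : {x : ℝ | ∃ i j : Fin n, M i j = x} = {x : ℝ | ∃ m : ℕ, 1 ≤ m ∧ m ≤ n ^ 2 ∧ (m : ℝ) = x}
  row_increasing : ∀ i : Fin n, StrictMono (fun j : Fin n => M i j)
  col_increasing : ∀ j : Fin n, StrictMono (fun i : Fin n => M i j)
  first_row : ∀ i j : Fin n, i.val = 0 → j.val < 2 → M i j = (j.val : ℝ) + 1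

/-! The vertex cross sums force `M i j = x i + y j + 1` with `x`, `y` strictly increasing and
natural. That each of `1, …, p ^ (2 * a)` occurs exactly once says that `(∑ X ^ x i) * (∑ X ^ y j)`
equals `1 + X + ⋯ + X ^ (p ^ (2 * a) - 1)`, the product of the cyclotomic polynomials of order `p ^
(i + 1)` for `i < 2 * a`. These are prime over `ℤ`, so the row factor is the subproduct over a set
`T` of positions (`exists_eq_digitPoly`). Each cyclotomic factor is `p` at `1`, hence `T` has `a`
elements; the entry `2` in the first row keeps `0` out of `T`. Conversely, every such `T` gives a
square (`isPrincipalReversibleSquare_digitSquare`), and distinct `T` give distinct squares, so the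
count is that of `a`-subsets of `2 * a - 1` positions. -/

open Polynomial Finset in
/-- The factor `1 + X ^ (p ^ i) + ⋯ + X ^ ((p - 1) p ^ i)`, which is the cyclotomic polynomial
of order `p ^ (i + 1)` when `p` is prime. -/
noncomputable def digitFactor (p i : ℕ) : ℕ[X] := ∑ j ∈ range p, (X ^ p ^ i) ^ j

open Polynomial Finset in
/-- The product of the factors `digitFactor p i` with `i ∈ T`. -/
noncomputable def digitPoly (p : ℕ) (T : Finset ℕ) : ℕ[X] := ∏ i ∈ T, digitFactor p i

/-- The numbers whose base `p` digits vanish outside the positions in `T`. -/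
noncomputable def digitSet (p : ℕ) (T : Finset ℕ) : Finset ℕ := (digitPoly p T).support

/-- The increasing enumeration of a finite set with `n` elements. -/
noncomputable def increasingEnum (s : Finset ℕ) (n : ℕ) (i : Fin n) : ℕ :=
  if h : s.card = n then s.orderEmbOfFin h i else 0

/-- The square attached to a set `T` of digit positions: rows carry the digits in `T`, columns
the remaining ones. -/
noncomputable def digitSquare (p a : ℕ) (T : Finset ℕ) : Matrix (Fin (p ^ a)) (Fin (p ^ a)) ℝ :=
  Matrix.of fun i j => (increasingEnum (digitSet p T) (p ^ a) i : ℝ)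
    + increasingEnum (digitSet p (Finset.range (2 * a) \ T)) (p ^ a) j + 1

/-! ### Increasing enumerations of finite sets -/

section Enumeration

variable {s : Finset ℕ} {n : ℕ}

theorem increasingEnum_eq (h : s.card = n) : increasingEnum s n = s.orderEmbOfFin h := by
  ext i; simp [increasingEnum, h]

theorem increasingEnum_strictMono (h : s.card = n) : StrictMono (increasingEnum s n) := by
  rw [increasingEnum_eq h]; exact (s.orderEmbOfFin h).strictMono

theorem increasingEnum_mem (h : s.card = n) (i : Fin n) : increasingEnum s n i ∈ s := by
  rw [increasingEnum_eq h]; exact s.orderEmbOfFin_mem h i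

theorem exists_increasingEnum_eq (h : s.card = n) {x : ℕ} (hx : x ∈ s) :
    ∃ i, increasingEnum s n i = x := by
  have : x ∈ Set.range (s.orderEmbOfFin h) := by rw [Finset.range_orderEmbOfFin]; exact hx
  rwa [increasingEnum_eq h]

theorem eq_increasingEnum (h : s.card = n) {f : Fin n → ℕ} (hf : ∀ i, f i ∈ s)
    (hmono : StrictMono f) : f = increasingEnum s n := by
  rw [increasingEnum_eq h]; exact Finset.orderEmbOfFin_unique h hf hmono

theorem increasingEnum_zero (h : s.card = n) (h0 : 0 ∈ s) (i : Fin n) (hi : i.val = 0) :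
    increasingEnum s n i = 0 := by
  obtain ⟨j, hj⟩ := exists_increasingEnum_eq h h0
  have : increasingEnum s n i ≤ increasingEnum s n j :=
    (increasingEnum_strictMono h).monotone (Fin.le_def.2 (by omega))
  omega

theorem increasingEnum_one (h : s.card = n) (h0 : 0 ∈ s) (h1 : 1 ∈ s) (i : Fin n)
    (hi : i.val = 1) : increasingEnum s n i = 1 := by
  obtain ⟨j, hj⟩ := exists_increasingEnum_eq h h1
  let z : Fin n := ⟨0, by omega⟩
  have hz : increasingEnum s n z = 0 := increasingEnum_zero h h0 z rfl
  have hpos : increasingEnum s n z < increasingEnum s n i :=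
    increasingEnum_strictMono h (Fin.lt_def.2 (by simp [z, hi]))
  have hj0 : j.val ≠ 0 := fun hj0 => by
    have := increasingEnum_zero h h0 j hj0
    omega
  have : increasingEnum s n i ≤ increasingEnum s n j :=
    (increasingEnum_strictMono h).monotone (Fin.le_def.2 (by omega))
  omega

/-- Reflecting in `N` and reversing the index gives another increasing enumeration of `s`, and that
is unique. -/
theorem increasingEnum_add_rev (h : s.card = n) {N : ℕ} (hN : ∀ x ∈ s, x ≤ N ∧ N - x ∈ s)
    (i : Fin n) : increasingEnum s n i + increasingEnum s n i.rev = N := by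
  have key : (fun i : Fin n => N - increasingEnum s n i.rev) = increasingEnum s n := by
    refine eq_increasingEnum h (fun i => (hN _ (increasingEnum_mem h _)).2) fun i j hij => ?_
    have h1 : increasingEnum s n j.rev < increasingEnum s n i.rev :=
      increasingEnum_strictMono h (Fin.rev_lt_rev.2 hij)
    have h2 := (hN _ (increasingEnum_mem h i.rev)).1
    show N - _ < N - _
    omega
  have h1 := congrFun key i
  have h2 := (hN _ (increasingEnum_mem h i.rev)).1
  omega

end Enumeration

/-! ### Digit polynomials, their supports and their factorizations -/

section DigitPolynomials

open Polynomial Finset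

theorem coeff_mul_coeff_le (f g : ℕ[X]) (x y : ℕ) :
    f.coeff x * g.coeff y ≤ (f * g).coeff (x + y) := by
  rw [coeff_mul]
  exact single_le_sum (f := fun z : ℕ × ℕ => f.coeff z.1 * g.coeff z.2)
    (fun _ _ => Nat.zero_le _) (a := (x, y)) (by simp)

/-- Natural coefficients cannot cancel, so the support of a product is the sumset of the supports.
-/
theorem mem_support_mul {f g : ℕ[X]} {k : ℕ} :
    k ∈ (f * g).support ↔ ∃ x ∈ f.support, ∃ y ∈ g.support, x + y = k := by
  constructor
  · intro hk
    rw [mem_support_iff, coeff_mul] at hk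
    obtain ⟨z, hz, hne⟩ := exists_ne_zero_of_sum_ne_zero hk
    exact ⟨z.1, mem_support_iff.2 (left_ne_zero_of_mul hne), z.2,
      mem_support_iff.2 (right_ne_zero_of_mul hne), mem_antidiagonal.1 hz⟩
  · rintro ⟨x, hx, y, hy, rfl⟩
    rw [mem_support_iff] at *
    have := coeff_mul_coeff_le f g x y
    have := Nat.mul_pos (Nat.pos_of_ne_zero hx) (Nat.pos_of_ne_zero hy)
    omega

variable {p : ℕ}

theorem mem_support_digitFactor {i k : ℕ} :
    k ∈ (digitFactor p i).support ↔ ∃ j < p, p ^ i * j = k := by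
  simp only [mem_support_iff, digitFactor, ← pow_mul, finsetSum_coeff, coeff_X_pow, ne_eq,
    sum_eq_zero_iff, mem_range, not_forall]
  constructor
  · rintro ⟨j, hj, h⟩; exact ⟨j, hj, by by_contra hne; exact h (if_neg fun e => hne e.symm)⟩
  · rintro ⟨j, hj, rfl⟩; exact ⟨j, hj, by simp⟩

theorem zero_mem_support_digitFactor (hp : p.Prime) (i : ℕ) : 0 ∈ (digitFactor p i).support :=
  mem_support_digitFactor.2 ⟨0, hp.pos, by simp⟩

theorem digitPoly_insert {T : Finset ℕ} {i : ℕ} (hi : i ∉ T) :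
    digitPoly p (insert i T) = digitFactor p i * digitPoly p T := prod_insert hi

theorem zero_mem_digitSet (hp : p.Prime) (T : Finset ℕ) : 0 ∈ digitSet p T := by
  induction T using Finset.induction with
  | empty => simp [digitSet, digitPoly]
  | insert i T hi ih =>
    rw [digitSet, digitPoly_insert hi, mem_support_mul]
    exact ⟨0, zero_mem_support_digitFactor hp i, 0, ih, rfl⟩

theorem pow_mem_digitSet (hp : p.Prime) {T : Finset ℕ} {i : ℕ} (hi : i ∈ T) :
    p ^ i ∈ digitSet p T := by
  rw [← insert_erase hi, digitSet, digitPoly_insert (notMem_erase i T), mem_support_mul]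
  exact ⟨p ^ i, mem_support_digitFactor.2 ⟨1, hp.one_lt, by simp⟩, 0,
    zero_mem_digitSet hp _, by simp⟩

/-- Replacing each digit `d` in `T` by `p - 1 - d` is the reflection; it yields the row and column
reversal symmetries. -/
theorem exists_digitSet_symm (p : ℕ) (T : Finset ℕ) :
    ∃ N, ∀ x ∈ digitSet p T, x ≤ N ∧ N - x ∈ digitSet p T := by
  induction T using Finset.induction with
  | empty => exact ⟨0, by simp [digitSet, digitPoly, coeff_one]⟩
  | insert i T hi ih =>
    obtain ⟨N, hN⟩ := ih
    refine ⟨p ^ i * (p - 1) + N, fun x hx => ?_⟩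
    rw [digitSet, digitPoly_insert hi, mem_support_mul] at hx ⊢
    obtain ⟨u, hu, v, hv, rfl⟩ := hx
    obtain ⟨j, hj, rfl⟩ := mem_support_digitFactor.1 hu
    obtain ⟨hvN, hv'⟩ := hN v hv
    have hsplit : p ^ i * j + p ^ i * (p - 1 - j) = p ^ i * (p - 1) := by
      rw [← mul_add]; congr 1; omega
    refine ⟨by omega, p ^ i * (p - 1 - j), mem_support_digitFactor.2 ⟨_, by omega, rfl⟩,
      N - v, hv', by omega⟩

theorem digitPoly_range (p m : ℕ) : digitPoly p (range m) = ∑ k ∈ range (p ^ m), X ^ k := by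
  -- Over `ℤ` one can multiply by `X - 1`, after which the product of geometric sums telescopes.
  apply map_injective (Nat.castRingHom ℤ) Nat.cast_injective
  have hX : (X - 1 : ℤ[X]) ≠ 0 := X_sub_C_ne_zero 1
  apply mul_right_cancel₀ hX
  simp only [Polynomial.map_sum, Polynomial.map_pow, map_X, geom_sum_mul]
  induction m with
  | zero => simp [digitPoly]
  | succ m ih =>
    rw [range_add_one, digitPoly_insert notMem_range_self, Polynomial.map_mul, mul_assoc, ih]
    simp only [digitFactor, Polynomial.map_sum, Polynomial.map_pow, map_X, geom_sum_mul]
    rw [← pow_mul, pow_succ]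

theorem digitPoly_mul_compl {m : ℕ} {T : Finset ℕ} (hT : T ⊆ range m) :
    digitPoly p T * digitPoly p (range m \ T) = ∑ k ∈ range (p ^ m), X ^ k := by
  rw [← digitPoly_range, mul_comm]; exact prod_sdiff hT

theorem coeff_geom_sum_nat (N k : ℕ) :
    (∑ i ∈ range N, X ^ i : ℕ[X]).coeff k = if k < N then 1 else 0 := by
  simp [finsetSum_coeff, coeff_X_pow]

/-- Multiplying by the complementary digit polynomial, whose constant term is nonzero, cannot lower
a coefficient, and the product has coefficients at most `1`. -/
theorem coeff_digitPoly_le_one (hp : p.Prime) (T : Finset ℕ) (k : ℕ) :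
    (digitPoly p T).coeff k ≤ 1 := by
  have hT : T ⊆ range (T.sup id + 1) := fun i hi =>
    mem_range.2 (Nat.lt_succ_of_le (le_sup (f := id) hi))
  have h := coeff_mul_coeff_le (digitPoly p T) (digitPoly p (range (T.sup id + 1) \ T)) k 0
  rw [digitPoly_mul_compl hT, coeff_geom_sum_nat] at h
  have h0 := mem_support_iff.1 (zero_mem_digitSet hp (range (T.sup id + 1) \ T))
  have := Nat.le_mul_of_pos_right ((digitPoly p T).coeff k) (Nat.pos_of_ne_zero h0)
  split_ifs at h <;> omega

theorem eval_one_digitPoly (p : ℕ) (T : Finset ℕ) : (digitPoly p T).eval 1 = p ^ T.card := by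
  simp [digitPoly, digitFactor, eval_prod, eval_finsetSum]

theorem card_digitSet (hp : p.Prime) (T : Finset ℕ) : (digitSet p T).card = p ^ T.card := by
  rw [← eval_one_digitPoly, eval_eq_sum, Polynomial.sum, card_eq_sum_ones]
  refine sum_congr rfl fun k hk => ?_
  have h1 := coeff_digitPoly_le_one hp T k
  have h2 := mem_support_iff.1 hk
  simp only [one_pow, mul_one]
  omega

theorem add_lt_of_mem_digitSet {m : ℕ} {T : Finset ℕ} (hT : T ⊆ range m) {x y : ℕ}
    (hx : x ∈ digitSet p T) (hy : y ∈ digitSet p (range m \ T)) : x + y < p ^ m := by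
  have h : x + y ∈ (digitPoly p T * digitPoly p (range m \ T)).support :=
    mem_support_mul.2 ⟨x, hx, y, hy, rfl⟩
  rw [digitPoly_mul_compl hT, mem_support_iff, coeff_geom_sum_nat] at h
  by_contra hlt
  exact h (if_neg hlt)

theorem exists_mem_digitSet_add_eq {m : ℕ} {T : Finset ℕ} (hT : T ⊆ range m) {k : ℕ}
    (hk : k < p ^ m) : ∃ x ∈ digitSet p T, ∃ y ∈ digitSet p (range m \ T), x + y = k := by
  refine mem_support_mul.1 ?_
  rw [digitPoly_mul_compl hT, mem_support_iff, coeff_geom_sum_nat, if_pos hk]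
  exact one_ne_zero

/-- Otherwise `x + 0` and `0 + x` contribute twice to a coefficient of the product that is at most
`1`. -/
theorem eq_zero_of_mem_digitSet_compl (hp : p.Prime) {m : ℕ} {T : Finset ℕ} (hT : T ⊆ range m)
    {x : ℕ} (hx : x ∈ digitSet p T) (hy : x ∈ digitSet p (range m \ T)) : x = 0 := by
  by_contra hx0
  have hsum := congrArg (coeff · x) (digitPoly_mul_compl (p := p) hT)
  simp only [coeff_geom_sum_nat, coeff_mul] at hsum
  have hsub : ({(x, 0), (0, x)} : Finset (ℕ × ℕ)) ⊆ antidiagonal x := by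
    intro z hz
    simp only [mem_insert, mem_singleton] at hz
    rcases hz with rfl | rfl <;> simp
  have hle := sum_le_sum_of_subset (f := fun z : ℕ × ℕ =>
    (digitPoly p T).coeff z.1 * (digitPoly p (range m \ T)).coeff z.2) hsub
  rw [sum_pair (by simp [hx0])] at hle
  have h1 := Nat.pos_of_ne_zero (mem_support_iff.1 hx)
  have h2 := Nat.pos_of_ne_zero (mem_support_iff.1 hy)
  have h3 := Nat.pos_of_ne_zero (mem_support_iff.1 (zero_mem_digitSet hp T))
  have h4 := Nat.pos_of_ne_zero (mem_support_iff.1 (zero_mem_digitSet hp (range m \ T)))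
  have h5 := Nat.mul_pos h1 h4
  have h6 := Nat.mul_pos h3 h2
  simp only at hle
  split_ifs at hsum <;> omega

theorem pow_mem_digitSet_iff (hp : p.Prime) {m : ℕ} {T : Finset ℕ} (hT : T ⊆ range m) {i : ℕ}
    (hi : i < m) : p ^ i ∈ digitSet p T ↔ i ∈ T := by
  refine ⟨fun h => ?_, pow_mem_digitSet hp⟩
  by_contra hiT
  exact pow_ne_zero i hp.ne_zero (eq_zero_of_mem_digitSet_compl hp hT h
    (pow_mem_digitSet hp (mem_sdiff.2 ⟨mem_range.2 hi, hiT⟩)))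

theorem digitSet_injOn (hp : p.Prime) {m : ℕ} {T T' : Finset ℕ} (hT : T ⊆ range m)
    (hT' : T' ⊆ range m) (h : digitSet p T = digitSet p T') : T = T' := by
  ext i
  by_cases hi : i < m
  · rw [← pow_mem_digitSet_iff hp hT hi, h, pow_mem_digitSet_iff hp hT' hi]
  · exact ⟨fun h => absurd (mem_range.1 (hT h)) hi, fun h => absurd (mem_range.1 (hT' h)) hi⟩

theorem map_digitFactor (hp : p.Prime) (i : ℕ) :
    (digitFactor p i).map (Nat.castRingHom ℤ) = cyclotomic (p ^ (i + 1)) ℤ := by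
  simp [digitFactor, cyclotomic_prime_pow_eq_geom_sum hp, Polynomial.map_sum]

theorem prime_map_digitFactor (hp : p.Prime) (i : ℕ) :
    Prime ((digitFactor p i).map (Nat.castRingHom ℤ)) := by
  rw [map_digitFactor hp]
  exact (cyclotomic.irreducible (pow_pos hp.pos _)).prime

/-- A factorization of `1 + X + ⋯ + X ^ (p ^ m - 1)` over the natural numbers distributes the
cyclotomic factors between the two factors. -/
theorem exists_eq_digitPoly (hp : p.Prime) {m : ℕ} {A B : ℕ[X]}
    (hAB : A * B = ∑ k ∈ range (p ^ m), X ^ k) :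
    ∃ T ⊆ range m, A = digitPoly p T ∧ B = digitPoly p (range m \ T) := by
  have hmul : A.map (Nat.castRingHom ℤ) * B.map (Nat.castRingHom ℤ)
      = 1 * ∏ i ∈ range m, (digitFactor p i).map (Nat.castRingHom ℤ) := by
    rw [← Polynomial.map_mul, hAB, ← digitPoly_range, digitPoly, Polynomial.map_prod, one_mul]
  obtain ⟨T, U, b, c, hunion, hdisj, hbc, hA, hB⟩ :=
    mul_eq_mul_prime_prod (fun i _ => prime_map_digitFactor hp i) hmul
  have hT : T ⊆ range m := hunion ▸ subset_union_left
  have hU : U = range m \ T := by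
    rw [← hunion, union_sdiff_cancel_left hdisj]
  have hb : b = 1 := by
    obtain ⟨r, hr, rfl⟩ := Polynomial.isUnit_iff.1 (IsUnit.of_mul_eq_one c hbc.symm)
    rcases Int.isUnit_iff.1 hr with rfl | rfl
    · simp
    -- The unit `-1` is excluded by signs at `1`: `A` takes a nonnegative value there and the digit
    -- polynomial a positive one.
    · have h := congrArg (eval 1) hA
      rw [← Polynomial.map_prod, ← digitPoly, eval_mul, eval_C, eval_one_map, eval_one_map,
        eval_one_digitPoly] at h
      simp only [eq_natCast] at h
      have : 0 < p ^ T.card := pow_pos hp.pos _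
      omega
  subst hb
  have hc : c = 1 := by simpa using hbc.symm
  refine ⟨T, hT, ?_, ?_⟩ <;> apply map_injective (Nat.castRingHom ℤ) Nat.cast_injective
  · rw [hA, one_mul, digitPoly, Polynomial.map_prod]
  · rw [hB, hc, one_mul, hU, digitPoly, Polynomial.map_prod]

end DigitPolynomials

/-! ### Correspondence between digit sets and squares -/

section Squares

open Polynomial Finset

variable {p a : ℕ}

theorem card_compl_of_card {T : Finset ℕ} (hT : T ⊆ range (2 * a)) (hcard : T.card = a) :
    (range (2 * a) \ T).card = a := by
  rw [card_sdiff_of_subset hT, card_range]; omega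

theorem isPrincipalReversibleSquare_digitSquare (hp : p.Prime) {T : Finset ℕ}
    (hT : T ⊆ range (2 * a)) (h0 : 0 ∉ T) (ha : 1 ≤ a) (hcard : T.card = a) :
    IsPrincipalReversibleSquare (digitSquare p a T) := by
  have hs : (digitSet p T).card = p ^ a := by rw [card_digitSet hp, hcard]
  have ht : (digitSet p (range (2 * a) \ T)).card = p ^ a := by
    rw [card_digitSet hp, card_compl_of_card hT hcard]
  obtain ⟨N, hN⟩ := exists_digitSet_symm p T
  obtain ⟨N', hN'⟩ := exists_digitSet_symm p (range (2 * a) \ T)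
  have hx := fun i => congrArg (Nat.cast (R := ℝ)) (increasingEnum_add_rev hs hN i)
  have hy := fun i => congrArg (Nat.cast (R := ℝ)) (increasingEnum_add_rev ht hN' i)
  push_cast at hx hy
  refine { row_reversal := ?_, col_reversal := ?_, vertex_cross_sum := ?_, entries := ?_,
           row_increasing := ?_, col_increasing := ?_, first_row := ?_ }
  · intro i j k
    simp only [digitSquare, Matrix.of_apply]
    linarith [hy j, hy k]
  · intro i j k
    simp only [digitSquare, Matrix.of_apply]
    linarith [hx i, hx k]
  · intro i j k l
    simp only [digitSquare, Matrix.of_apply]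
    ring
  · ext r
    simp only [digitSquare, Matrix.of_apply, Set.mem_ofPred_eq]
    constructor
    · rintro ⟨i, j, rfl⟩
      have hlt := add_lt_of_mem_digitSet hT (increasingEnum_mem hs i) (increasingEnum_mem ht j)
      rw [pow_mul, pow_right_comm] at hlt
      exact ⟨_ + _ + 1, Nat.le_add_left 1 _, hlt, by push_cast; rfl⟩
    · rintro ⟨k, hk1, hk, rfl⟩
      rw [← pow_mul, mul_comm] at hk
      obtain ⟨x, hx, y, hy, hxy⟩ :=
        exists_mem_digitSet_add_eq (p := p) (k := k - 1) hT (by omega)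
      obtain ⟨i, rfl⟩ := exists_increasingEnum_eq hs hx
      obtain ⟨j, rfl⟩ := exists_increasingEnum_eq ht hy
      refine ⟨i, j, ?_⟩
      rw [← Nat.cast_add, hxy, Nat.cast_sub hk1]
      simp
  · intro i j k hjk
    simpa [digitSquare] using increasingEnum_strictMono ht hjk
  · intro i j k hjk
    simpa [digitSquare] using increasingEnum_strictMono hs hjk
  · intro i j hi hj
    have h1 : 1 ∈ digitSet p (range (2 * a) \ T) := by
      simpa using pow_mem_digitSet hp (i := 0)
        (mem_sdiff.2 ⟨mem_range.2 (by omega : 0 < 2 * a), h0⟩)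
    have hj' : increasingEnum (digitSet p (range (2 * a) \ T)) (p ^ a) j = j.val := by
      rcases (by omega : j.val = 0 ∨ j.val = 1) with h | h
      · rw [h]; exact increasingEnum_zero ht (zero_mem_digitSet hp _) j h
      · rw [h]; exact increasingEnum_one ht (zero_mem_digitSet hp _) h1 j h
    simp [digitSquare, hj', increasingEnum_zero hs (zero_mem_digitSet hp _) i hi]

theorem digitSquare_injOn (hp : p.Prime) {T T' : Finset ℕ} (hT : T ⊆ range (2 * a))
    (hT' : T' ⊆ range (2 * a)) (hcard : T.card = a) (hcard' : T'.card = a)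
    (h : digitSquare p a T = digitSquare p a T') : T = T' := by
  have hs : (digitSet p T).card = p ^ a := by rw [card_digitSet hp, hcard]
  have hs' : (digitSet p T').card = p ^ a := by rw [card_digitSet hp, hcard']
  -- The column enumeration vanishes at `z`, so the first column determines the row enumeration.
  let z : Fin (p ^ a) := ⟨0, pow_pos hp.pos a⟩
  have henum : increasingEnum (digitSet p T) (p ^ a) = increasingEnum (digitSet p T') (p ^ a) := by
    ext i
    have h1 := congrFun (congrFun h i) z
    simp only [digitSquare, Matrix.of_apply] at h1
    rw [increasingEnum_zero (by rw [card_digitSet hp, card_compl_of_card hT hcard])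
        (zero_mem_digitSet hp _) z rfl,
      increasingEnum_zero (by rw [card_digitSet hp, card_compl_of_card hT' hcard'])
        (zero_mem_digitSet hp _) z rfl] at h1
    simpa using h1
  apply digitSet_injOn hp hT hT'
  rw [increasingEnum_eq hs, increasingEnum_eq hs'] at henum
  have := congrArg Set.range henum
  rwa [range_orderEmbOfFin, range_orderEmbOfFin, coe_inj] at this

theorem IsPrincipalReversibleSquare.exists_nat {n : ℕ} {M : Matrix (Fin n) (Fin n) ℝ}
    (hM : IsPrincipalReversibleSquare M) (hn : 2 ≤ n) :
    ∃ x y : Fin n → ℕ, StrictMono x ∧ StrictMono y ∧ y ⟨1, hn⟩ = 1 ∧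
      ∀ i j, M i j = x i + y j + 1 := by
  let z : Fin n := ⟨0, by omega⟩
  have hz : M z z = 1 := by simpa [z] using hM.first_row z z rfl (by simp [z])
  have hz1 : M z ⟨1, hn⟩ = 2 := by
    have := hM.first_row z ⟨1, hn⟩ rfl (by simp)
    norm_num at this
    exact this
  have hnat : ∀ i j, ∃ m : ℕ, M i j = m + 1 := fun i j => by
    obtain ⟨m, hm1, -, hm⟩ := hM.entries.subset ⟨i, j, rfl⟩
    exact ⟨m - 1, by rw [← hm, Nat.cast_sub hm1]; simp⟩
  choose f hf using hnat
  refine ⟨fun i => f i z, fun j => f z j, fun i j hij => ?_, fun i j hij => ?_, ?_, fun i j => ?_⟩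
  · have : M i z < M j z := hM.col_increasing z hij
    simpa [hf] using this
  · have : M z i < M z j := hM.row_increasing z hij
    simpa [hf] using this
  · have : (f z ⟨1, hn⟩ : ℝ) = 1 := by linarith [hf z ⟨1, hn⟩]
    exact_mod_cast this
  · linarith [hM.vertex_cross_sum i j z z, hf i z, hf z j]

theorem IsPrincipalReversibleSquare.sum_mul_sum_X_pow {n : ℕ} {M : Matrix (Fin n) (Fin n) ℝ}
    (hM : IsPrincipalReversibleSquare M) {x y : Fin n → ℕ} (hxy : ∀ i j, M i j = x i + y j + 1) :
    (∑ i, X ^ x i) * (∑ j, X ^ y j) = (∑ k ∈ range (n ^ 2), X ^ k : ℕ[X]) := by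
  have himage : univ.image (fun z : Fin n × Fin n => x z.1 + y z.2) = range (n ^ 2) := by
    ext k
    simp only [mem_image, mem_univ, true_and, Prod.exists, mem_range]
    constructor
    · rintro ⟨i, j, rfl⟩
      obtain ⟨m, -, hm, hm'⟩ := hM.entries.subset ⟨i, j, rfl⟩
      rw [hxy] at hm'
      have : m = x i + y j + 1 := by exact_mod_cast hm'
      omega
    · intro hk
      obtain ⟨i, j, hij⟩ := hM.entries.superset ⟨k + 1, by omega, hk, rfl⟩
      rw [hxy] at hij
      have : x i + y j + 1 = k + 1 := by exact_mod_cast hij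
      exact ⟨i, j, by omega⟩
  -- The `n ^ 2` index pairs hit `n ^ 2` values, so no entry repeats.
  have hinj : Set.InjOn (fun z : Fin n × Fin n => x z.1 + y z.2) (univ : Finset (Fin n × Fin n)) := by
    rw [← card_image_iff, himage]
    simp [sq]
  rw [← himage, sum_image hinj, sum_mul_sum, ← univ_product_univ, sum_product]
  simp only [pow_add]

theorem IsPrincipalReversibleSquare.exists_digitSquare (hp : p.Prime) (ha : 1 ≤ a)
    {M : Matrix (Fin (p ^ a)) (Fin (p ^ a)) ℝ} (hM : IsPrincipalReversibleSquare M) :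
    ∃ T ⊆ range (2 * a), 0 ∉ T ∧ T.card = a ∧ digitSquare p a T = M := by
  have hn : 2 ≤ p ^ a := hp.two_le.trans (Nat.le_self_pow (by omega) p)
  obtain ⟨x, y, hx, hy, hy1, hxy⟩ := hM.exists_nat hn
  have hprod := hM.sum_mul_sum_X_pow hxy
  rw [← pow_mul, mul_comm a 2] at hprod
  obtain ⟨T, hT, hA, hB⟩ := exists_eq_digitPoly hp hprod
  have hcard : T.card = a := by
    have h := congrArg (eval 1) hA
    rw [eval_one_digitPoly] at h
    simp [eval_finsetSum] at h
    exact (Nat.pow_right_injective hp.two_le h).symm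
  have hmem : ∀ (u : Fin (p ^ a) → ℕ) (S : Finset ℕ), ∑ i, X ^ u i = digitPoly p S →
      ∀ i, u i ∈ digitSet p S := fun u S h i => by
    rw [digitSet, ← h, mem_support_iff, finsetSum_coeff]
    simp only [coeff_X_pow]
    intro h0
    simpa using (sum_eq_zero_iff.1 h0) i (mem_univ i)
  have hxmem := hmem x T hA
  have hymem := hmem y _ hB
  refine ⟨T, hT, fun h0 => ?_, hcard, ?_⟩
  -- If `0 ∈ T`, then `1` lies in the row digit set as well as in the column one, where `hy1` puts
  -- it.
  · have h1 : 1 ∈ digitSet p T := by simpa using pow_mem_digitSet hp h0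
    exact one_ne_zero (eq_zero_of_mem_digitSet_compl hp hT h1 (hy1 ▸ hymem ⟨1, hn⟩))
  · have hs : (digitSet p T).card = p ^ a := by rw [card_digitSet hp, hcard]
    have ht : (digitSet p (range (2 * a) \ T)).card = p ^ a := by
      rw [card_digitSet hp, card_compl_of_card hT hcard]
    ext i j
    rw [hxy, eq_increasingEnum hs hxmem hx, eq_increasingEnum ht hymem hy]
    rfl

end Squares

theorem mainTheorem4 (p a : ℕ) (hp : p.Prime) (ha : 1 ≤ a) :
    {M : Matrix (Fin (p ^ a)) (Fin (p ^ a)) ℝ | IsPrincipalReversibleSquare M}.encard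
      = ((2 * a - 1).choose a : ℕ∞) := by
  have hsub : ∀ T : Finset ℕ, T ⊆ Finset.Ico 1 (2 * a) ↔ T ⊆ Finset.range (2 * a) ∧ 0 ∉ T := by
    refine fun T => ⟨fun h => ⟨fun i hi => ?_, fun h0 => ?_⟩, fun h i hi => ?_⟩
    · exact Finset.mem_range.2 (Finset.mem_Ico.1 (h hi)).2
    · simpa using h h0
    · have hi0 : i ≠ 0 := fun e => h.2 (e ▸ hi)
      exact Finset.mem_Ico.2 ⟨by omega, Finset.mem_range.1 (h.1 hi)⟩
  have himage : {M : Matrix (Fin (p ^ a)) (Fin (p ^ a)) ℝ | IsPrincipalReversibleSquare M}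
      = digitSquare p a '' (Finset.powersetCard a (Finset.Ico 1 (2 * a)) : Set (Finset ℕ)) := by
    ext M
    simp only [Set.mem_ofPred_eq, Set.mem_image, Finset.mem_coe, Finset.mem_powersetCard, hsub]
    constructor
    · intro hM
      obtain ⟨T, hT, h0, hcard, rfl⟩ := hM.exists_digitSquare hp ha
      exact ⟨T, ⟨⟨hT, h0⟩, hcard⟩, rfl⟩
    · rintro ⟨T, ⟨⟨hT, h0⟩, hcard⟩, rfl⟩
      exact isPrincipalReversibleSquare_digitSquare hp hT h0 ha hcard
  rw [himage, Set.InjOn.encard_image, Set.encard_coe_eq_coe_finsetCard, Finset.card_powersetCard,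
    Nat.card_Ico]
  intro T hT T' hT' h
  simp only [Finset.mem_coe, Finset.mem_powersetCard, hsub] at hT hT'
  exact digitSquare_injOn hp hT.1.1 hT'.1.1 hT.2 hT'.2 h
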